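/- Let $H$ be a separable infinite-dimensional complex Hilbert space and let $K(H)$ be the algebra of compact operators on $H$. For a positive $a\in K(H)$ let $\lambda_1(a)\ge\lambda_2(a)\ge\cdots$ be the sequence of its nonzero eigenvalues in decreasing order, counted with multiplicity, with zeros appended if $a$ has finite rank. Let $\alpha:\{0,1,2,\dots\}\to[0,\infty)$ be a monotone increasing (not necessarily strictly) function with $\alpha(0)=0$ and $\alpha(1)>0$, put $c_i:=\alpha(i)-\alpha(i-1)$ for $i=1,2,\dots$, and define the non-linear trace of Choquet type $$\varphi_\alpha(a):=\sum_{i=1}^{\infty}\bigl(\lambda_i(a)-\lambda_{i+1}(a)\bigr)\,\alpha(i)\in[0,\infty]\qquad (a\in K(H),\ a\ge 0).$$ Fix a real number $p\ge 1$ and set $|||a|||_{\alpha,p}:=\varphi_\alpha(|a|^p)^{1/p}\in[0,\infty]$ for $a\in K(H)$, where $|a|=(a^*a)^{1/2}$ and $\infty^{1/p}=\infty$. Then the following conditions are equivalent: 1. $\alpha$ is concave, in the sense that $\dfrac{\alpha(i+1)+\alpha(i-1)}{2}\le\alpha(i)$ for all $i=1,2,3,\dots$; 2. $(c_i)_i$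 is a decreasing sequence: $c_1\ge c_2\ge\cdots\ge c_n\ge\cdots$; 3. $|||\cdot|||_{\alpha,p}$ satisfies the triangle inequality, the value $+\infty$ being allowed: $|||a+b|||_{\alpha,p}\le|||a|||_{\alpha,p}+|||b|||_{\alpha,p}$ for all $a,b\in K(H)$. -/

import Mathlib

open scoped ENNReal

/-- `s` lists the eigenvalues of the positive compact operator `a` on an infinite dimensional
Hilbert space in decreasing order, repeated according to multiplicity and padded with zeros if `a`
has finite rank: `s` decreases to `0`, and `a = ∑ n, s n • p n` where `p n` is the rank one
projection onto the line spanned by the `n`-th vector of an orthonormal sequence.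
(Indexing starts at `0`: `s n` is the `(n + 1)`-st eigenvalue. If some `s n` vanishes, then so do all
the later ones and `a` has finite rank, so if `a` has infinite rank then no `s n` is zero. The
vectors orthogonal to the sequence lie in the kernel of `a`, so every nonzero eigenvalue is listed
as often as its multiplicity, and `a` determines `s`.) -/
structure IsEigenvalueSequence {H : Type*} [NormedAddCommGroup H] [InnerProductSpace ℂ H]
    (a : H →L[ℂ] H) (s : ℕ → ℝ) : Prop where
  antitone : Antitone s
  tendsto_zero : Filter.Tendsto s Filter.atTop (nhds 0)
  decomposition : ∃ e : ℕ → H, Orthonormal ℂ e ∧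
    ∀ x : H, HasSum (fun n => (s n : ℂ) • (inner ℂ (e n) x • e n)) (a x)

open Classical in
/-- The eigenvalue sequence `λ(a)` of a positive compact operator `a` on an infinite dimensional
Hilbert space, indexed from `0` (and `0` for operators which have no eigenvalue sequence). -/
noncomputable def eigenvalueSequence {H : Type*} [NormedAddCommGroup H] [InnerProductSpace ℂ H]
    (a : H →L[ℂ] H) : ℕ → ℝ :=
  if h : ∃ s, IsEigenvalueSequence a s then h.choose else 0

/-- The non-linear trace of Choquet type associated with `α`,
`φ_α(a) = ∑_{i ≥ 1} (λ_i(a) - λ_{i+1}(a)) α(i)`, with values in `[0, ∞]`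
(the index `i` below is one less, since `eigenvalueSequence` starts at `0`). -/
noncomputable def choquetTrace {H : Type*} [NormedAddCommGroup H] [InnerProductSpace ℂ H]
    (α : ℕ → ℝ) (a : H →L[ℂ] H) : ℝ≥0∞ :=
  ∑' i : ℕ, ENNReal.ofReal
    ((eigenvalueSequence a i - eigenvalueSequence a (i + 1)) * α (i + 1))

/-- `|||a|||_{α,p} = φ_α(|a|^p)^{1/p}`, with values in `[0, ∞]`; the operators `|a| = (a* a)^{1/2}`
and `|a|^p` are given by the continuous functional calculus. -/
noncomputable def choquetSchattenNorm {H : Type*} [NormedAddCommGroup H] [InnerProductSpace ℂ H]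
    [CompleteSpace H] (α : ℕ → ℝ) (p : ℝ) (a : H →L[ℂ] H) : ℝ≥0∞ :=
  choquetTrace α ((CFC.abs a) ^ p) ^ (1 / p)

/-! Summation by parts (`tsum_sub_mul_eq_tsum_mul`) turns the trace into `∑ c_k λ_k`, so the
functional is the `c`-weighted `ℓ^p` norm of the singular values. For this, eigenvalue sequences
must exist (spectral theorem), be unique (the definition picks one by choice), and follow `T ↦ T ^
q`.

If `c` decreases, Ky Fan's inequality bounds the partial sums of the singular values of `a + b` by
those of the sum of the two singular value sequences (`sum_eigenvalues_abs_add_le`). Abel summation,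
convexity of `t ^ p` and Minkowski's inequality carry this over to the weighted norms
(`weightedNorm_le_add`).

Conversely, the triangle inequality is tested on two diagonal operators with eigenvalues `1, …, 1,
1, r`, the last two eigenvectors being swapped in one of them; their sum has eigenvalues `2, …, 2, 1
+ r, 1 + r`. With `c`, `d` the two weights involved, what remains is `(c + d) * ((1 + r) / 2) ^ p ≤
c + d * r ^ p`, an equality at `r = 1`; comparing derivatives there gives `d ≤ c`. -/

/-- Once `s n` is subtracted from `s`, the terms before `n` are nonnegative and the later ones
nonpositive, so the best weight is the indicator of the first `n` indices. The bound on the total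
weight pays for the subtraction. -/
theorem sum_mul_le_sum_range_of_antitone {s d : ℕ → ℝ} (hs : Antitone s) (hs0 : ∀ k, 0 ≤ s k)
    (hd0 : ∀ k, 0 ≤ d k) (hd1 : ∀ k, d k ≤ 1) {n N : ℕ} (hnN : n ≤ N)
    (hd : ∑ k ∈ Finset.range N, d k ≤ n) :
    ∑ k ∈ Finset.range N, s k * d k ≤ ∑ k ∈ Finset.range n, s k := by
  have h1 : ∑ k ∈ Finset.range N, (s k - s n) * d k ≤ ∑ k ∈ Finset.range n, (s k - s n) := by
    rw [← Finset.sum_range_add_sum_Ico _ hnN]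
    have h2 : ∑ k ∈ Finset.range n, (s k - s n) * d k ≤ ∑ k ∈ Finset.range n, (s k - s n) := by
      refine Finset.sum_le_sum fun k hk => ?_
      have : s n ≤ s k := hs (Finset.mem_range.1 hk).le
      exact mul_le_of_le_one_right (by linarith) (hd1 k)
    have h3 : ∑ k ∈ Finset.Ico n N, (s k - s n) * d k ≤ 0 := by
      refine Finset.sum_nonpos fun k hk => ?_
      have : s k ≤ s n := hs (Finset.mem_Ico.1 hk).1
      exact mul_nonpos_of_nonpos_of_nonneg (by linarith) (hd0 k)
    linarith
  simp only [sub_mul, Finset.sum_sub_distrib, ← Finset.mul_sum, Finset.sum_const,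
    Finset.card_range, nsmul_eq_mul] at h1
  nlinarith [hs0 n]

/-! ### Ky Fan's inequality and uniqueness of eigenvalue sequences -/

section Bessel

variable {H : Type*} [NormedAddCommGroup H] [InnerProductSpace ℂ H]

/-- A sequence of vectors satisfying Bessel's inequality. -/
def IsBessel (v : ℕ → H) : Prop :=
  ∀ (x : H) (F : Finset ℕ), ∑ i ∈ F, ‖inner ℂ (v i) x‖ ^ 2 ≤ ‖x‖ ^ 2

theorem Orthonormal.isBessel {v : ℕ → H} (hv : Orthonormal ℂ v) : IsBessel v :=
  fun x _ => hv.sum_inner_products_le x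

theorem IsBessel.norm_le_one {v : ℕ → H} (hv : IsBessel v) (i : ℕ) : ‖v i‖ ≤ 1 := by
  have h := hv (v i) {i}
  rw [Finset.sum_singleton, inner_self_eq_norm_sq_to_K] at h
  norm_num at h
  by_contra! h1
  have h2 : 1 < ‖v i‖ ^ 2 := by nlinarith
  nlinarith

theorem IsBessel.sum_mul_le {v w : ℕ → H} (hv : IsBessel v) (hw : IsBessel w) {x y : H}
    (hx : ‖x‖ ≤ 1) (hy : ‖y‖ ≤ 1) (F : Finset ℕ) :
    ∑ i ∈ F, ‖inner ℂ (v i) x‖ * ‖inner ℂ (w i) y‖ ≤ 1 := by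
  have h1 := hv x F
  have h2 := hw y F
  have h3 : ∑ i ∈ F, 2 * (‖inner ℂ (v i) x‖ * ‖inner ℂ (w i) y‖) ≤
      ∑ i ∈ F, (‖inner ℂ (v i) x‖ ^ 2 + ‖inner ℂ (w i) y‖ ^ 2) :=
    Finset.sum_le_sum fun i _ => by
      nlinarith [two_mul_le_add_sq ‖inner ℂ (v i) x‖ ‖inner ℂ (w i) y‖]
  rw [← Finset.mul_sum, Finset.sum_add_distrib] at h3
  have h4 : ‖x‖ ^ 2 ≤ 1 := by nlinarith [norm_nonneg x]
  have h5 : ‖y‖ ^ 2 ≤ 1 := by nlinarith [norm_nonneg y]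
  linarith

/-- The Ky Fan inequality for an operator with a singular value decomposition. -/
theorem norm_sum_inner_le_sum_range {a : H → H} {s : ℕ → ℝ} {u v e f : ℕ → H}
    (hs : Antitone s) (hs0 : ∀ k, 0 ≤ s k) (hu : IsBessel u) (hv : IsBessel v)
    (he : IsBessel e) (hf : IsBessel f)
    (ha : ∀ x, HasSum (fun k => (s k : ℂ) • (inner ℂ (u k) x • v k)) (a x)) (n : ℕ) :
    ‖∑ j ∈ Finset.range n, inner ℂ (f j) (a (e j))‖ ≤ ∑ k ∈ Finset.range n, s k := by
  have h1 : HasSum (fun k => ∑ j ∈ Finset.range n,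
      inner ℂ (f j) ((s k : ℂ) • (inner ℂ (u k) (e j) • v k)))
      (∑ j ∈ Finset.range n, inner ℂ (f j) (a (e j))) :=
    hasSum_sum fun j _ => (ha (e j)).mapL (innerSL ℂ (f j))
  refine le_of_tendsto h1.tendsto_sum_nat.norm ?_
  filter_upwards [Filter.eventually_ge_atTop n] with N hN
  -- Bessel for `e`, `f` gives `d k ≤ 1`; Bessel for `u`, `v` bounds the total weight by `n`.
  set d : ℕ → ℝ := fun k => ∑ j ∈ Finset.range n, ‖inner ℂ (e j) (u k)‖ * ‖inner ℂ (f j) (v k)‖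
    with hd
  calc _ ≤ ∑ k ∈ Finset.range N, s k * d k := by
        refine (norm_sum_le _ _).trans (Finset.sum_le_sum fun k _ => ?_)
        refine (norm_sum_le _ _).trans ?_
        rw [hd, Finset.mul_sum]
        refine Finset.sum_le_sum fun j _ => ?_
        rw [inner_smul_right, inner_smul_right, norm_mul, norm_mul, Complex.norm_real,
          Real.norm_of_nonneg (hs0 k), norm_inner_symm (u k)]
    _ ≤ _ := by
        refine sum_mul_le_sum_range_of_antitone hs hs0 (fun k => by positivity)
          (fun k => he.sum_mul_le hf (hu.norm_le_one k) (hv.norm_le_one k) _) hN ?_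
        rw [Finset.sum_comm]
        calc _ ≤ ∑ j ∈ Finset.range n, (1 : ℝ) := by
              refine Finset.sum_le_sum fun j _ => ?_
              simp only [norm_inner_symm (e j), norm_inner_symm (f j)]
              exact hu.sum_mul_le hv (he.norm_le_one j) (hf.norm_le_one j) _
          _ = n := by simp

theorem apply_eq_smul_of_hasSum {a : H → H} {s : ℕ → ℝ} {e : ℕ → H} (he : Orthonormal ℂ e)
    (ha : ∀ x, HasSum (fun k => (s k : ℂ) • (inner ℂ (e k) x • e k)) (a x)) (n : ℕ) :
    a (e n) = (s n : ℂ) • e n := by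
  refine (ha (e n)).unique ?_
  convert hasSum_single (f := fun k => (s k : ℂ) • (inner ℂ (e k) (e n) • e k)) n ?_ using 1
  · simp [inner_self_eq_norm_sq_to_K, he.1 n]
  · intro k hk
    simp [he.2 hk]

theorem IsEigenvalueSequence.nonneg {a : H →L[ℂ] H} {s : ℕ → ℝ} (h : IsEigenvalueSequence a s)
    (n : ℕ) : 0 ≤ s n :=
  h.antitone.le_of_tendsto h.tendsto_zero n

/-- Ky Fan's inequality for the decomposition with `t`, tested on the eigenvectors belonging to `s`.
-/
theorem IsEigenvalueSequence.sum_le {a : H →L[ℂ] H} {s t : ℕ → ℝ}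
    (hs : IsEigenvalueSequence a s) (ht : IsEigenvalueSequence a t) (n : ℕ) :
    ∑ k ∈ Finset.range n, s k ≤ ∑ k ∈ Finset.range n, t k := by
  obtain ⟨e, he, hae⟩ := hs.decomposition
  obtain ⟨f, hf, haf⟩ := ht.decomposition
  have h := norm_sum_inner_le_sum_range ht.antitone ht.nonneg hf.isBessel hf.isBessel he.isBessel
    he.isBessel haf n
  have h1 : ∑ j ∈ Finset.range n, inner ℂ (e j) (a (e j)) =
      ((∑ k ∈ Finset.range n, s k : ℝ) : ℂ) := by
    push_cast
    refine Finset.sum_congr rfl fun j _ => ?_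
    rw [apply_eq_smul_of_hasSum he hae, inner_smul_right, inner_self_eq_norm_sq_to_K, he.1 j]
    simp
  rw [h1, Complex.norm_real] at h
  exact (Real.le_norm_self _).trans h

theorem IsEigenvalueSequence.unique {a : H →L[ℂ] H} {s t : ℕ → ℝ}
    (hs : IsEigenvalueSequence a s) (ht : IsEigenvalueSequence a t) : s = t := by
  have h : ∀ n, ∑ k ∈ Finset.range n, s k = ∑ k ∈ Finset.range n, t k :=
    fun n => le_antisymm (hs.sum_le ht n) (ht.sum_le hs n)
  ext n
  have h1 := h (n + 1)
  rw [Finset.sum_range_succ, Finset.sum_range_succ, h n] at h1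
  linarith

theorem IsEigenvalueSequence.eigenvalueSequence_eq {a : H →L[ℂ] H} {s : ℕ → ℝ}
    (hs : IsEigenvalueSequence a s) : eigenvalueSequence a = s := by
  have h : ∃ s, IsEigenvalueSequence a s := ⟨s, hs⟩
  rw [eigenvalueSequence, dif_pos h]
  exact h.choose_spec.unique hs

end Bessel

/-! ### Functional calculus on eigenvectors -/

section FunctionalCalculus

variable {H : Type*} [NormedAddCommGroup H] [InnerProductSpace ℂ H]

theorem mem_spectrum_real_of_apply_eq_smul {T : H →L[ℂ] H} {x : H} (hx0 : x ≠ 0) {r : ℝ}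
    (hx : T x = (r : ℂ) • x) : r ∈ spectrum ℝ T := by
  intro hu
  have hu' : IsUnit (algebraMap ℝ (H →L[ℂ] H) r - T) := hu
  obtain ⟨S, hS⟩ := hu'.exists_left_inv
  have h1 : (algebraMap ℝ (H →L[ℂ] H) r - T) x = 0 := by
    simp [Algebra.algebraMap_eq_smul_one, hx]
  have h2 := congrArg (fun A : H →L[ℂ] H => A x) hS
  simp only [mul_apply_eq_comp, h1, map_zero, one_apply_eq_self] at h2
  exact hx0 h2.symm

variable [CompleteSpace H]

/-- The identity holds for constants and the coordinate function and survives sums, products and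
uniform limits, so Stone–Weierstrass applies. -/
theorem cfc_apply_of_apply_eq_smul {T : H →L[ℂ] H} (hT : IsSelfAdjoint T) {x : H} {r : ℝ}
    (hx : T x = (r : ℂ) • x) {f : ℝ → ℝ} (hf : ContinuousOn f (spectrum ℝ T)) :
    cfc f T x = (f r : ℂ) • x := by
  rcases eq_or_ne x 0 with rfl | hx0
  · simp
  have hr := mem_spectrum_real_of_apply_eq_smul hx0 hx
  have key : ∀ g : C(spectrum ℝ T, ℝ), cfcHom hT g x = (g ⟨r, hr⟩ : ℂ) • x := by
    intro g
    have hid : cfcHom hT (.restrict (spectrum ℝ T) (.id ℝ)) x = (r : ℂ) • x := by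
      rw [cfcHom_id hT, hx]
    induction g using ContinuousMap.induction_on_of_compact with
    | const c =>
      have : ContinuousMap.const (spectrum ℝ T) c = algebraMap ℝ C(spectrum ℝ T, ℝ) c := rfl
      rw [this, AlgHomClass.commutes]
      simp [Algebra.algebraMap_eq_smul_one]
    | id => exact hid
    | star_id =>
      have : star (ContinuousMap.restrict (spectrum ℝ T) (.id ℝ)) = .restrict _ (.id ℝ) := by
        ext; simp
      rw [this]; exact hid
    | add f g hf hg => simp [map_add, hf, hg, add_smul]
    | mul f g hf hg =>
      rw [map_mul, mul_apply_eq_comp, hg, map_smul, hf, smul_smul, ContinuousMap.mul_apply,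
        Complex.ofReal_mul, mul_comm]
    | frequently f h =>
      have hcl : IsClosed {g : C(spectrum ℝ T, ℝ) | cfcHom hT g x = (g ⟨r, hr⟩ : ℂ) • x} := by
        refine isClosed_eq ?_ ?_
        · exact (ContinuousLinearMap.apply ℂ H x).continuous.comp (cfcHom_continuous hT)
        · exact (Complex.continuous_ofReal.comp (continuous_eval_const _)).smul continuous_const
      exact hcl.mem_of_frequently_of_tendsto h Filter.tendsto_id
  rw [cfc_apply f T hT hf, key]
  rfl

theorem Orthonormal.summable_inner_smul {e : ℕ → H} (he : Orthonormal ℂ e) (x : H) :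
    Summable fun n => inner ℂ (e n) x • e n := by
  have := (he.orthogonalFamily.summable_iff_norm_sq_summable
    (fun n => inner ℂ (e n) x)).2 (he.inner_products_summable x)
  simpa using this

theorem IsEigenvalueSequence.rpow {T : H →L[ℂ] H} (hT : 0 ≤ T) {s : ℕ → ℝ}
    (hs : IsEigenvalueSequence T s) {q : ℝ} (hq : 0 < q) :
    IsEigenvalueSequence (T ^ q) (fun n => s n ^ q) where
  antitone m n h := Real.rpow_le_rpow (hs.nonneg n) (hs.antitone h) hq.le
  tendsto_zero := by
    have := hs.tendsto_zero.rpow_const (Or.inr hq.le)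
    rwa [Real.zero_rpow hq.ne'] at this
  decomposition := by
    obtain ⟨e, he, hTe⟩ := hs.decomposition
    refine ⟨e, he, fun x => ?_⟩
    have hsa : IsSelfAdjoint T := .of_nonneg hT
    have hcont : ContinuousOn (fun r : ℝ => r ^ q) (spectrum ℝ T) :=
      (Real.continuous_rpow_const hq.le).continuousOn
    rw [CFC.rpow_eq_cfc_real hT]
    -- `y` is the projection of `x` onto the closed span of `e`. The rest `x - y` lies in the kernel
    -- of `T`, hence in that of `T ^ q`, because `0 ^ q = 0`.
    obtain ⟨y, hy⟩ := he.summable_inner_smul x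
    have hinner : ∀ n, inner ℂ (e n) y = inner ℂ (e n) x := by
      intro n
      have h1 : HasSum (fun k => inner ℂ (e n) (inner ℂ (e k) x • e k)) (inner ℂ (e n) y) :=
        hy.mapL (innerSL ℂ (e n))
      rw [h1.unique (hasSum_single n fun k hk => by
        rw [inner_smul_right, he.2 hk.symm, mul_zero]), inner_smul_right,
        inner_self_eq_norm_sq_to_K, he.1 n]
      simp
    have hker : T (x - y) = ((0 : ℝ) : ℂ) • (x - y) := by
      have h1 := hTe (x - y)
      simp only [inner_sub_right, hinner, sub_self, zero_smul, smul_zero] at h1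
      rw [h1.unique hasSum_zero]
      simp
    have h2 := cfc_apply_of_apply_eq_smul hsa hker hcont
    rw [Real.zero_rpow hq.ne', Complex.ofReal_zero, zero_smul, map_sub, sub_eq_zero] at h2
    rw [h2]
    convert hy.mapL (cfc (fun r : ℝ => r ^ q) T) using 1
    ext n
    rw [map_smul, cfc_apply_of_apply_eq_smul hsa (apply_eq_smul_of_hasSum he hTe n) hcont,
      smul_comm]

end FunctionalCalculus

/-! ### Spectral theorem for positive compact operators -/

section Spectral

variable {H : Type*} [NormedAddCommGroup H] [InnerProductSpace ℂ H]

theorem inner_sub_sum_inner_smul {e : ℕ → H} (he : Orthonormal ℂ e) (x : H) {F : Finset ℕ} {m : ℕ}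
    (hm : m ∈ F) : inner ℂ (e m) (x - ∑ k ∈ F, inner ℂ (e k) x • e k) = 0 := by
  rw [inner_sub_right, he.inner_right_sum _ hm, sub_self]

open scoped ComplexOrder in
/-- A positive compact operator has an eigenvector in every nonzero closed invariant subspace
whose eigenvalue is the norm of the restriction. -/
theorem exists_eigenvector_norm_le {T : H →L[ℂ] H} (hT : 0 ≤ T) (hc : IsCompactOperator T)
    (V : Submodule ℂ H) [CompleteSpace V] [Nontrivial V] (hV : ∀ x ∈ V, T x ∈ V) :
    ∃ x ∈ V, ∃ r : ℝ, ‖x‖ = 1 ∧ 0 ≤ r ∧ T x = (r : ℂ) • x ∧ ∀ y ∈ V, ‖T y‖ ≤ r * ‖y‖ := by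
  have hpos := (ContinuousLinearMap.nonneg_iff_isPositive T).1 hT
  set S : V →L[ℂ] V := T.restrict hV with hS
  have hSc : IsCompactOperator S := hc.restrict' hV
  have hSsymm : S.IsSymmetric := hpos.isSymmetric.restrict_invariant hV
  have hnorm : ∀ y ∈ V, ‖T y‖ ≤ ‖S‖ * ‖y‖ := fun y hy => S.le_opNorm ⟨y, hy⟩
  rcases eq_or_ne S 0 with h0 | h0
  · have hS0 : ‖S‖ = 0 := (norm_eq_zero (a := S)).2 h0
    simp only [hS0] at hnorm
    obtain ⟨x, hx⟩ := exists_norm_eq V zero_le_one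
    refine ⟨x, x.2, 0, hx, le_rfl, ?_, hnorm⟩
    have := hnorm x x.2
    rw [zero_mul, norm_le_zero_iff] at this
    simp [this]
  -- Self-adjointness yields a spectral value of modulus `‖S‖`; being nonzero, it is an eigenvalue
  -- by compactness, and positivity then makes it equal to `‖S‖`.
  · obtain ⟨k, hk, hkn⟩ := spectrum.exists_nnnorm_eq_spectralRadius S
    rw [S.spectralRadius_eq_nnnorm hSsymm.isSelfAdjoint, ENNReal.coe_inj] at hkn
    have hkn' : ‖k‖ = ‖S‖ := congrArg NNReal.toReal hkn
    have hk0 : k ≠ 0 := by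
      rw [← norm_ne_zero_iff, hkn']
      exact (norm_ne_zero_iff (a := S)).2 h0
    obtain ⟨z, hz⟩ := ((hSc.hasEigenvalue_iff_mem_spectrum hk0).2 hk).exists_hasEigenvector
    have hz0 : ‖z‖ ≠ 0 := norm_ne_zero_iff.2 hz.2
    have hTz : T z = k • (z : H) := congrArg Subtype.val hz.apply_eq_smul
    have hkS : k = (‖S‖ : ℂ) := by
      have h1 := hpos.inner_nonneg_right (z : H)
      rw [hTz, inner_smul_right, inner_self_eq_norm_sq_to_K] at h1
      have h2 : 0 < ‖(z : H)‖ ^ 2 := pow_pos ((norm_nonneg z).lt_of_ne' hz0) 2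
      have h3 : 0 ≤ k := by
        have h4 : k * ((‖(z : H)‖ ^ 2 : ℝ) : ℂ) * (((‖(z : H)‖ ^ 2)⁻¹ : ℝ) : ℂ) = k := by
          rw [mul_assoc, ← Complex.ofReal_mul, mul_inv_cancel₀ h2.ne', Complex.ofReal_one, mul_one]
        rw [← h4]
        refine mul_nonneg ?_ (Complex.zero_le_real.2 (inv_nonneg.2 h2.le))
        simpa using h1
      rw [← hkn']
      exact (Complex.norm_of_nonneg' h3).symm
    refine ⟨((‖z‖⁻¹ : ℝ) : ℂ) • (z : H), V.smul_mem _ z.2, ‖S‖, ?_, norm_nonneg S, ?_, hnorm⟩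
    · rw [norm_smul, Complex.norm_real, norm_inv, norm_norm]
      exact inv_mul_cancel₀ hz0
    · rw [map_smul, hTz, hkS, smul_comm]

variable [CompleteSpace H]

/-- Greedy choice: the orthogonal complement of the eigenvectors found so far is invariant, and
nonzero in infinite dimension, so it contains a norm-attaining eigenvector. -/
theorem exists_eigenvector_seq (hH : ¬ FiniteDimensional ℂ H) {T : H →L[ℂ] H} (hT : 0 ≤ T)
    (hc : IsCompactOperator T) :
    ∃ (e : ℕ → H) (s : ℕ → ℝ), Orthonormal ℂ e ∧ (∀ n, 0 ≤ s n) ∧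
      (∀ n, T (e n) = (s n : ℂ) • e n) ∧
      ∀ n y, (∀ m < n, inner ℂ (e m) y = 0) → ‖T y‖ ≤ s n * ‖y‖ := by
  have hsymm := ((ContinuousLinearMap.nonneg_iff_isPositive T).1 hT).isSymmetric
  -- The eigenvector hypothesis sits inside the existential so that `choose` gives functions of `F`
  -- alone, usable in a recursion.
  have step : ∀ F : Finset H, ∃ (x : H) (r : ℝ), (∀ z ∈ F, ∃ c : ℂ, T z = c • z) →
      ‖x‖ = 1 ∧ 0 ≤ r ∧ T x = (r : ℂ) • x ∧ (∀ z ∈ F, inner ℂ z x = 0) ∧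
      ∀ y, (∀ z ∈ F, inner ℂ z y = 0) → ‖T y‖ ≤ r * ‖y‖ := by
    intro F
    by_cases hF : ∀ z ∈ F, ∃ c : ℂ, T z = c • z
    swap
    · exact ⟨0, 0, fun h => absurd h hF⟩
    set W := Submodule.span ℂ (F : Set H)
    have hmem : ∀ y, y ∈ Wᗮ ↔ ∀ z ∈ F, inner ℂ z y = 0 := by
      intro y
      rw [Submodule.mem_orthogonal]
      refine ⟨fun h z hz => h z (Submodule.subset_span hz), fun h u hu => ?_⟩
      induction hu using Submodule.span_induction with
      | mem z hz => exact h z hz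
      | zero => simp
      | add a b _ _ ha hb => rw [inner_add_left, ha, hb, add_zero]
      | smul c a _ ha => rw [inner_smul_left, ha, mul_zero]
    have : FiniteDimensional ℂ W := FiniteDimensional.span_finset ℂ F
    have : Nontrivial Wᗮ := by
      rw [Submodule.nontrivial_iff_ne_bot, Ne, Submodule.orthogonal_eq_bot_iff]
      intro h
      apply hH
      rw [h] at this
      exact Module.Finite.equiv Submodule.topEquiv
    obtain ⟨x, hx, r, h1, h2, h3, h4⟩ := exists_eigenvector_norm_le hT hc Wᗮ (by
      intro y hy
      rw [hmem] at hy ⊢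
      intro z hz
      obtain ⟨c, hcz⟩ := hF z hz
      have := hsymm z y
      simp only [ContinuousLinearMap.coe_coe] at this
      rw [← this, hcz, inner_smul_left, hy z hz, mul_zero])
    exact ⟨x, r, fun _ => ⟨h1, h2, h3, (hmem x).1 hx, fun y hy => h4 y ((hmem y).2 hy)⟩⟩
  choose g r hg using step
  classical
  let S : ℕ → Finset H := fun n => n.rec ∅ (fun _ F => insert (g F) F)
  have hS1 : ∀ n, S (n + 1) = insert (g (S n)) (S n) := fun n => rfl
  have hSmem : ∀ n z, z ∈ S n ↔ ∃ m < n, z = g (S m) := by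
    intro n z
    induction n with
    | zero => simp [S]
    | succ n ih =>
      rw [hS1, Finset.mem_insert, ih]
      constructor
      · rintro (h | ⟨m, hm, h⟩)
        exacts [⟨n, n.lt_succ_self, h⟩, ⟨m, hm.trans n.lt_succ_self, h⟩]
      · rintro ⟨m, hm, h⟩
        rcases Nat.lt_succ_iff_lt_or_eq.1 hm with hm | rfl
        exacts [Or.inr ⟨m, hm, h⟩, Or.inl h]
  have hgood : ∀ n, ∀ z ∈ S n, ∃ c : ℂ, T z = c • z := by
    intro n
    induction n with
    | zero => simp [S]
    | succ n ih =>
      intro z hz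
      rw [hS1, Finset.mem_insert] at hz
      rcases hz with rfl | hz
      exacts [⟨_, (hg _ ih).2.2.1⟩, ih z hz]
  have horth : ∀ m n, m < n → inner ℂ (g (S m)) (g (S n)) = 0 := fun m n h =>
    (hg _ (hgood n)).2.2.2.1 _ ((hSmem n _).2 ⟨m, h, rfl⟩)
  refine ⟨fun n => g (S n), fun n => r (S n), ⟨fun n => (hg _ (hgood n)).1, fun m n hmn => ?_⟩,
    fun n => (hg _ (hgood n)).2.1, fun n => (hg _ (hgood n)).2.2.1, fun n y hy => ?_⟩
  · rcases hmn.lt_or_gt with h | h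
    · exact horth m n h
    · exact inner_eq_zero_symm.1 (horth n m h)
  · refine (hg _ (hgood n)).2.2.2.2 y fun z hz => ?_
    obtain ⟨m, hm, rfl⟩ := (hSmem n z).1 hz
    exact hy m hm

theorem exists_isEigenvalueSequence (hH : ¬ FiniteDimensional ℂ H) {T : H →L[ℂ] H} (hT : 0 ≤ T)
    (hc : IsCompactOperator T) : ∃ s, IsEigenvalueSequence T s := by
  obtain ⟨e, s, he, hs0, hTe, hle⟩ := exists_eigenvector_seq hH hT hc
  have hanti : Antitone s := antitone_nat_of_succ_le fun n => by
    have h := hle n (e (n + 1)) fun m hm => he.2 (by omega)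
    rwa [hTe, norm_smul, he.1, mul_one, mul_one, Complex.norm_real,
      Real.norm_of_nonneg (hs0 _)] at h
  have htend : Filter.Tendsto s Filter.atTop (nhds 0) := by
    have hbdd : BddBelow (Set.range s) := ⟨0, by rintro _ ⟨n, rfl⟩; exact hs0 n⟩
    have hL := tendsto_atTop_ciInf hanti hbdd
    set L := ⨅ n, s n
    have hLs : ∀ n, L ≤ s n := fun n => ciInf_le hbdd n
    have hL0 : 0 ≤ L := le_ciInf hs0
    rcases hL0.eq_or_lt with h | h
    · rwa [← h] at hL
    exfalso
    -- If `L > 0`, the vectors `T (e n)` are orthogonal of norm at least `L`, so no subsequence is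
    -- Cauchy.
    obtain ⟨K, hK, hTK⟩ := hc.image_closedBall_subset_compact 1
    obtain ⟨y, -, φ, hφ, hy⟩ := hK.tendsto_subseq (x := fun n => T (e n))
      fun n => hTK ⟨e n, by simp [he.1], rfl⟩
    obtain ⟨N, hN⟩ := Metric.cauchySeq_iff'.1 hy.cauchySeq L h
    have h1 := hN (N + 1) N.le_succ
    have hne : φ (N + 1) ≠ φ N := (hφ N.lt_succ_self).ne'
    simp only [Function.comp_apply] at h1
    have h2 : ‖T (e (φ (N + 1))) - T (e (φ N))‖ ^ 2 = s (φ (N + 1)) ^ 2 + s (φ N) ^ 2 := by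
      rw [@norm_sub_sq ℂ, hTe, hTe, inner_smul_left, inner_smul_right, he.2 hne]
      simp [norm_smul, he.1]
    rw [dist_eq_norm] at h1
    nlinarith [hLs (φ (N + 1)), hLs (φ N), norm_nonneg (T (e (φ (N + 1))) - T (e (φ N)))]
  refine ⟨s, hanti, htend, e, he, fun x => ?_⟩
  rw [HasSum, SummationFilter.unconditional_filter, tendsto_iff_norm_sub_tendsto_zero]
  rw [Metric.tendsto_atTop]
  intro ε hε
  have h1 : Filter.Tendsto (fun n => s n * ‖x‖) Filter.atTop (nhds 0) := by
    simpa using htend.mul_const ‖x‖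
  obtain ⟨n, hn⟩ := (h1.eventually_lt_const hε).exists
  refine ⟨Finset.range n, fun F hF => ?_⟩
  -- The error is `T` applied to a vector orthogonal to the first `n` eigenvectors and no longer
  -- than `x`, so it is at most `s n * ‖x‖`.
  have h2 : ∑ k ∈ F, (s k : ℂ) • (inner ℂ (e k) x • e k) - T x =
      -T (x - ∑ k ∈ F, inner ℂ (e k) x • e k) := by
    simp only [map_sub, map_sum, map_smul, hTe, neg_sub]
    congr 1
    exact Finset.sum_congr rfl fun k _ => smul_comm _ _ _
  have h3 := hle n (x - ∑ k ∈ F, inner ℂ (e k) x • e k) fun m hm =>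
    inner_sub_sum_inner_smul he x (hF (Finset.mem_range.2 hm))
  have h4 : ‖x - ∑ k ∈ F, inner ℂ (e k) x • e k‖ ≤ ‖x‖ := by
    have h5 : inner ℂ (∑ k ∈ F, inner ℂ (e k) x • e k)
        (x - ∑ k ∈ F, inner ℂ (e k) x • e k) = 0 := by
      rw [sum_inner]
      refine Finset.sum_eq_zero fun k hk => ?_
      rw [inner_smul_left, inner_sub_sum_inner_smul he x hk, mul_zero]
    have h6 := norm_add_sq_eq_norm_sq_add_norm_sq_of_inner_eq_zero _ _ h5
    rw [add_sub_cancel] at h6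
    nlinarith [norm_nonneg x, norm_nonneg (x - ∑ k ∈ F, inner ℂ (e k) x • e k),
      norm_nonneg (∑ k ∈ F, inner ℂ (e k) x • e k)]
  rw [h2, norm_neg, dist_zero_right, norm_norm]
  exact (h3.trans (mul_le_mul_of_nonneg_left h4 (hs0 n))).trans_lt hn

end Spectral

/-! ### Singular values of a sum -/

section SingularValues

variable {H : Type*} [NormedAddCommGroup H] [InnerProductSpace ℂ H] [CompleteSpace H]

theorem inner_abs_abs (a : H →L[ℂ] H) (x y : H) :
    inner ℂ (CFC.abs a x) (CFC.abs a y) = inner ℂ (a x) (a y) := by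
  have h1 : inner ℂ (CFC.abs a x) (CFC.abs a y) = inner ℂ x ((CFC.abs a * CFC.abs a) y) := by
    have := ((ContinuousLinearMap.nonneg_iff_isPositive _).1 (CFC.abs_nonneg a)).isSymmetric x
      (CFC.abs a y)
    simpa using this
  rw [h1, CFC.abs_mul_abs, ContinuousLinearMap.star_eq_adjoint, mul_apply_eq_comp,
    ContinuousLinearMap.adjoint_inner_right]

theorem norm_abs_apply (a : H →L[ℂ] H) (x : H) : ‖CFC.abs a x‖ = ‖a x‖ := by
  rw [@norm_eq_sqrt_re_inner ℂ, @norm_eq_sqrt_re_inner ℂ, inner_abs_abs]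

theorem exists_isEigenvalueSequence_abs (hH : ¬ FiniteDimensional ℂ H) {a : H →L[ℂ] H}
    (ha : IsCompactOperator a) : ∃ s, IsEigenvalueSequence (CFC.abs a) s := by
  have h0 : 0 ≤ star a * a := star_mul_self_nonneg a
  obtain ⟨t, ht⟩ := exists_isEigenvalueSequence hH h0 (ha.clm_comp (star a))
  rw [CFC.abs, CFC.sqrt_eq_rpow]
  exact ⟨_, ht.rpow h0 (by norm_num)⟩

/-- Take `v k = (s k)⁻¹ • a (u k)`. Since `0⁻¹ = 0`, this vanishes where `s k = 0`, which is why `v`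
is only claimed to be Bessel and not orthonormal. -/
theorem IsEigenvalueSequence.exists_svd {a : H →L[ℂ] H} {s : ℕ → ℝ}
    (hs : IsEigenvalueSequence (CFC.abs a) s) :
    ∃ u v : ℕ → H, IsBessel u ∧ IsBessel v ∧
      (∀ x, HasSum (fun k => (s k : ℂ) • (inner ℂ (u k) x • v k)) (a x)) ∧
      ∀ k, inner ℂ (v k) (a (u k)) = s k := by
  obtain ⟨u, hu, hau⟩ := hs.decomposition
  have heig := apply_eq_smul_of_hasSum hu hau
  have hinner : ∀ j k, inner ℂ (a (u j)) (a (u k)) = (s j * s k : ℂ) * inner ℂ (u j) (u k) := by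
    intro j k
    rw [← inner_abs_abs, heig, heig, inner_smul_left, inner_smul_right, Complex.conj_ofReal,
      mul_assoc]
  have hzero : ∀ k, s k = 0 → a (u k) = 0 := fun k hk => by
    rw [← norm_eq_zero, ← norm_abs_apply, heig, hk]
    simp
  have hsv : ∀ k, (s k : ℂ) • (((s k)⁻¹ : ℝ) : ℂ) • a (u k) = a (u k) := fun k => by
    rcases eq_or_ne (s k) 0 with h | h
    · rw [hzero k h, smul_zero, smul_zero]
    · rw [smul_smul, ← Complex.ofReal_mul, mul_inv_cancel₀ h, Complex.ofReal_one, one_smul]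
  refine ⟨u, fun k => (((s k)⁻¹ : ℝ) : ℂ) • a (u k), hu.isBessel, ?_, fun x => ?_, fun k => ?_⟩
  · intro x F
    have horth : Orthonormal ℂ (fun k : {k // s k ≠ 0} => (((s k)⁻¹ : ℝ) : ℂ) • a (u k)) := by
      rw [orthonormal_iff_ite]
      intro j k
      rw [inner_smul_left, inner_smul_right, hinner, orthonormal_iff_ite.1 hu,
        Complex.conj_ofReal]
      by_cases hjk : j = k
      · subst hjk
        have : (s j : ℂ) ≠ 0 := Complex.ofReal_ne_zero.2 j.2
        simp [this]
      · simp [hjk, Subtype.val_injective.ne hjk]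
    have h := horth.sum_inner_products_le x (s := F.subtype (fun k => s k ≠ 0))
    refine le_trans (le_of_eq ?_) h
    rw [Finset.sum_subtype_eq_sum_filter
      (f := fun k => ‖inner ℂ ((((s k)⁻¹ : ℝ) : ℂ) • a (u k)) x‖ ^ 2), Finset.sum_filter_of_ne]
    intro k _ hk h0
    simp [h0] at hk
  · have h1 := hau x
    -- The errors for `a` and `|a|` are images of the same vector, hence have equal norm, so
    -- convergence transfers.
    rw [HasSum, tendsto_iff_norm_sub_tendsto_zero] at h1 ⊢
    refine h1.congr fun F => ?_
    have h2 : ∀ b : H →L[ℂ] H, ∑ k ∈ F, inner ℂ (u k) x • b (u k) - b x =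
        b (∑ k ∈ F, inner ℂ (u k) x • u k - x) := fun b => by simp
    have h3 : ∀ k, (s k : ℂ) • (inner ℂ (u k) x • u k) = inner ℂ (u k) x • CFC.abs a (u k) :=
      fun k => by rw [smul_comm, heig]
    have h4 : ∀ k, (s k : ℂ) • (inner ℂ (u k) x • (((s k)⁻¹ : ℝ) : ℂ) • a (u k)) =
        inner ℂ (u k) x • a (u k) := fun k => by rw [smul_comm, hsv]
    simp only [h3, h4]
    rw [h2, h2 a, norm_abs_apply]
  · rw [inner_smul_left, hinner, inner_self_eq_norm_sq_to_K, hu.1, Complex.conj_ofReal]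
    rcases eq_or_ne (s k) 0 with h | h
    · simp [h]
    · have : (s k : ℂ) ≠ 0 := Complex.ofReal_ne_zero.2 h
      simp [this]

/-- The singular vectors of `a + b` realise the left side as a sum of inner products, linear in the
operator; Ky Fan bounds the contributions of `a` and `b` separately. -/
theorem sum_eigenvalues_abs_add_le {a b : H →L[ℂ] H} {s t w : ℕ → ℝ}
    (hs : IsEigenvalueSequence (CFC.abs a) s) (ht : IsEigenvalueSequence (CFC.abs b) t)
    (hw : IsEigenvalueSequence (CFC.abs (a + b)) w) (n : ℕ) :
    ∑ k ∈ Finset.range n, w k ≤ ∑ k ∈ Finset.range n, (s k + t k) := by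
  obtain ⟨ua, va, hua, hva, ha, -⟩ := hs.exists_svd
  obtain ⟨ub, vb, hub, hvb, hb, -⟩ := ht.exists_svd
  obtain ⟨u, v, hu, hv, -, hab⟩ := hw.exists_svd
  have h1 := norm_sum_inner_le_sum_range hs.antitone hs.nonneg hua hva hu hv ha n
  have h2 := norm_sum_inner_le_sum_range ht.antitone ht.nonneg hub hvb hu hv hb n
  have h3 : ((∑ k ∈ Finset.range n, w k : ℝ) : ℂ) =
      ∑ k ∈ Finset.range n, inner ℂ (v k) (a (u k)) +
        ∑ k ∈ Finset.range n, inner ℂ (v k) (b (u k)) := by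
    push_cast
    rw [← Finset.sum_add_distrib]
    refine Finset.sum_congr rfl fun k _ => ?_
    rw [← hab k, add_apply, inner_add_right]
  rw [Finset.sum_add_distrib]
  calc ∑ k ∈ Finset.range n, w k ≤ ‖((∑ k ∈ Finset.range n, w k : ℝ) : ℂ)‖ := by
        rw [Complex.norm_real]; exact Real.le_norm_self _
    _ ≤ _ := by rw [h3]; exact (norm_add_le _ _).trans (add_le_add h1 h2)

end SingularValues

/-! ### Weighted `ℓ^p` norms of sequences -/

section Sequences

/-- If the partial sums of `y` dominate those of `x`, so do the partial sums weighted by an antitone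
nonnegative sequence. -/
theorem sum_mul_le_sum_mul_of_antitone {w x y : ℕ → ℝ} (hw : Antitone w) (hw0 : ∀ k, 0 ≤ w k)
    {n : ℕ} (h : ∀ m ≤ n, ∑ k ∈ Finset.range m, x k ≤ ∑ k ∈ Finset.range m, y k) :
    ∑ k ∈ Finset.range n, w k * x k ≤ ∑ k ∈ Finset.range n, w k * y k := by
  have key : ∀ m ≤ n, w m * ∑ k ∈ Finset.range m, (y k - x k) ≤
      ∑ k ∈ Finset.range m, w k * (y k - x k) := by
    intro m
    induction m with
    | zero => simp
    | succ m ih =>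
      intro hm
      have h1 := ih (by omega)
      have h2 : 0 ≤ ∑ k ∈ Finset.range (m + 1), (y k - x k) := by
        rw [Finset.sum_sub_distrib]; linarith [h (m + 1) hm]
      have h3 := mul_le_mul_of_nonneg_right (hw m.le_succ) h2
      rw [Finset.sum_range_succ] at h3 ⊢
      rw [Finset.sum_range_succ]
      rw [Nat.succ_eq_add_one] at h3
      linarith [mul_add (w m) (∑ k ∈ Finset.range m, (y k - x k)) (y m - x m)]
  have h1 := key n le_rfl
  have h2 : 0 ≤ ∑ k ∈ Finset.range n, (y k - x k) := by
    rw [Finset.sum_sub_distrib]; linarith [h n le_rfl]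
  have h3 := mul_nonneg (hw0 n) h2
  simp only [mul_sub, Finset.sum_sub_distrib] at h1 h3
  linarith

/-- The graph of `t ↦ t ^ p` lies above its tangents. -/
theorem rpow_add_mul_sub_le_rpow {p : ℝ} (hp : 1 ≤ p) {x y : ℝ} (hx : 0 ≤ x) (hy : 0 ≤ y) :
    x ^ p + p * x ^ (p - 1) * (y - x) ≤ y ^ p := by
  rcases hx.eq_or_lt with rfl | hx
  · rcases hp.eq_or_lt with rfl | hp
    · simp
    · rw [Real.zero_rpow (by linarith), Real.zero_rpow (by linarith)]
      simpa using Real.rpow_nonneg hy p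
  · have h1 := one_add_mul_self_le_rpow_one_add (s := y / x - 1) (by
      have := div_nonneg hy hx.le; linarith) hp
    have h2 := mul_le_mul_of_nonneg_left h1 (Real.rpow_nonneg hx.le p)
    rw [add_sub_cancel, ← Real.mul_rpow hx.le (div_nonneg hy hx.le), mul_div_cancel₀ _ hx.ne'] at h2
    refine le_trans (le_of_eq ?_) h2
    rw [Real.rpow_sub_one hx.ne']
    field_simp

/-- Bound `y k ^ p` below by the tangent at `x k`. The slopes weighted by `c` decrease in `k`, so
Abel summation shows that the linear terms add up to something nonnegative; `y` need not be
monotone. -/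
theorem sum_mul_rpow_le {p : ℝ} (hp : 1 ≤ p) {c x y : ℕ → ℝ} (hc : Antitone c)
    (hc0 : ∀ k, 0 ≤ c k) (hx : Antitone x) (hx0 : ∀ k, 0 ≤ x k) (hy0 : ∀ k, 0 ≤ y k) {n : ℕ}
    (h : ∀ m ≤ n, ∑ k ∈ Finset.range m, x k ≤ ∑ k ∈ Finset.range m, y k) :
    ∑ k ∈ Finset.range n, c k * x k ^ p ≤ ∑ k ∈ Finset.range n, c k * y k ^ p := by
  have hw : Antitone fun k => c k * x k ^ (p - 1) := fun i j hij =>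
    mul_le_mul (hc hij) (Real.rpow_le_rpow (hx0 j) (hx hij) (by linarith))
      (Real.rpow_nonneg (hx0 j) _) (hc0 i)
  have h1 := sum_mul_le_sum_mul_of_antitone hw
    (fun k => mul_nonneg (hc0 k) (Real.rpow_nonneg (hx0 k) _)) h
  have h2 : ∑ k ∈ Finset.range n, (c k * x k ^ p +
      p * (c k * x k ^ (p - 1) * y k - c k * x k ^ (p - 1) * x k)) ≤
      ∑ k ∈ Finset.range n, c k * y k ^ p := by
    refine Finset.sum_le_sum fun k _ => ?_
    have := mul_le_mul_of_nonneg_left (rpow_add_mul_sub_le_rpow hp (hx0 k) (hy0 k)) (hc0 k)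
    linarith
  rw [Finset.sum_add_distrib, ← Finset.mul_sum, Finset.sum_sub_distrib] at h2
  nlinarith

/-- The weighted `ℓ^p` norm of a nonnegative sequence. -/
noncomputable def weightedNorm (c : ℕ → ℝ) (p : ℝ) (s : ℕ → ℝ) : ℝ≥0∞ :=
  (∑' k, ENNReal.ofReal (c k) * ENNReal.ofReal (s k) ^ p) ^ (1 / p)

/-- Finite truncations avoid infinite values; there, Minkowski's inequality applies to the sequences
multiplied by `c k ^ p⁻¹`. -/
theorem weightedNorm_le_add {p : ℝ} (hp : 1 ≤ p) {c x y z : ℕ → ℝ} (hc : Antitone c)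
    (hc0 : ∀ k, 0 ≤ c k) (hx : Antitone x) (hx0 : ∀ k, 0 ≤ x k) (hy0 : ∀ k, 0 ≤ y k)
    (hz0 : ∀ k, 0 ≤ z k)
    (h : ∀ n, ∑ k ∈ Finset.range n, x k ≤ ∑ k ∈ Finset.range n, (y k + z k)) :
    weightedNorm c p x ≤ weightedNorm c p y + weightedNorm c p z := by
  have hp0 : 0 < p := by linarith
  have hpn : p ≠ 0 := hp0.ne'
  rw [weightedNorm, one_div, ENNReal.rpow_inv_le_iff hp0, ENNReal.tsum_eq_iSup_nat]
  refine iSup_le fun n => ?_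
  rw [← ENNReal.rpow_inv_le_iff hp0]
  have hofReal : ∀ s : ℕ → ℝ, (∀ k, 0 ≤ s k) →
      ∑ k ∈ Finset.range n, ENNReal.ofReal (c k) * ENNReal.ofReal (s k) ^ p =
        ENNReal.ofReal (∑ k ∈ Finset.range n, c k * s k ^ p) := by
    intro s hs
    rw [ENNReal.ofReal_sum_of_nonneg fun k _ => mul_nonneg (hc0 k) (Real.rpow_nonneg (hs k) _)]
    refine Finset.sum_congr rfl fun k _ => ?_
    rw [ENNReal.ofReal_mul (hc0 k), ENNReal.ofReal_rpow_of_nonneg (hs k) hp0.le]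
  have hweight : ∀ s : ℕ → ℝ≥0∞, ∀ k, (ENNReal.ofReal (c k) ^ p⁻¹ * s k) ^ p =
      ENNReal.ofReal (c k) * s k ^ p := by
    intro s k
    rw [ENNReal.mul_rpow_of_nonneg _ _ hp0.le, ENNReal.rpow_inv_rpow hpn]
  have hfin : ∀ s : ℕ → ℝ, (∑ k ∈ Finset.range n,
      (ENNReal.ofReal (c k) ^ p⁻¹ * ENNReal.ofReal (s k)) ^ p) ^ (1 / p) ≤ weightedNorm c p s := by
    intro s
    rw [weightedNorm]
    simp only [hweight fun k => ENNReal.ofReal (s k)]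
    exact ENNReal.rpow_le_rpow (ENNReal.sum_le_tsum _) (by positivity)
  refine le_trans ?_ (add_le_add (hfin y) (hfin z))
  refine le_trans ?_ (ENNReal.Lp_add_le _ _ _ hp)
  rw [one_div]
  refine ENNReal.rpow_le_rpow ?_ (by positivity)
  simp only [← mul_add, hweight fun k => ENNReal.ofReal (y k) + ENNReal.ofReal (z k)]
  simp only [← ENNReal.ofReal_add (hy0 _) (hz0 _)]
  rw [hofReal x hx0, hofReal (fun k => y k + z k) fun k => add_nonneg (hy0 k) (hz0 k)]
  exact ENNReal.ofReal_le_ofReal (sum_mul_rpow_le hp hc hc0 hx hx0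
    (fun k => add_nonneg (hy0 k) (hz0 k)) fun m _ => h m)

/-- Summation by parts for a decreasing sequence with limit zero. -/
theorem tsum_sub_mul_eq_tsum_mul {α : ℕ → ℝ} (hα : Monotone α) (hα0 : α 0 = 0) {s : ℕ → ℝ}
    (hs : Antitone s) (hs0 : Filter.Tendsto s Filter.atTop (nhds 0)) :
    ∑' i, ENNReal.ofReal ((s i - s (i + 1)) * α (i + 1)) =
      ∑' k, ENNReal.ofReal (α (k + 1) - α k) * ENNReal.ofReal (s k) := by
  -- Each `s k` telescopes over its tail. Exchanging the sums leaves, for each `i`, the increments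
  -- of `α` up to `i`, which total `α (i + 1)`.
  have htail : ∀ k, ENNReal.ofReal (s k) =
      ∑' i, if k ≤ i then ENNReal.ofReal (s i - s (i + 1)) else 0 := by
    intro k
    have hnn : ∀ i, 0 ≤ s (i + k) - s (i + 1 + k) := fun i => sub_nonneg.2 (hs (by omega))
    have h1 : HasSum (fun i => s (i + k) - s (i + 1 + k)) (s k) := by
      rw [hasSum_iff_tendsto_nat_of_nonneg hnn]
      have h2 : ∀ n, ∑ i ∈ Finset.range n, (s (i + k) - s (i + 1 + k)) = s k - s (n + k) := by
        intro n
        rw [Finset.sum_range_sub' (fun i => s (i + k)), zero_add]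
      simp only [h2]
      simpa using ((Filter.tendsto_add_atTop_iff_nat k).2 hs0).const_sub (s k)
    rw [← h1.tsum_eq, ENNReal.ofReal_tsum_of_nonneg hnn h1.summable,
      ← Summable.sum_add_tsum_nat_add' (f := fun i =>
        if k ≤ i then ENNReal.ofReal (s i - s (i + 1)) else 0) (k := k)
        ENNReal.summable, Finset.sum_eq_zero, zero_add]
    · refine tsum_congr fun i => ?_
      rw [if_pos (by omega), add_right_comm]
    · intro i hi
      rw [if_neg (by have := Finset.mem_range.1 hi; omega)]
  simp only [htail, ← ENNReal.tsum_mul_left]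
  rw [ENNReal.tsum_comm]
  refine tsum_congr fun i => ?_
  have h1 : α (i + 1) = ∑ k ∈ Finset.range (i + 1), (α (k + 1) - α k) := by
    rw [Finset.sum_range_sub, hα0, sub_zero]
  rw [ENNReal.ofReal_mul (sub_nonneg.2 (hs i.le_succ)), h1,
    ENNReal.ofReal_sum_of_nonneg fun k _ => sub_nonneg.2 (hα k.le_succ), Finset.mul_sum,
    tsum_eq_sum (s := Finset.range (i + 1))]
  · refine Finset.sum_congr rfl fun k hk => ?_
    rw [if_pos (by have := Finset.mem_range.1 hk; omega), mul_comm]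
  · intro k hk
    rw [if_neg (by have := Finset.mem_range.not.1 hk; omega), mul_zero]

end Sequences

/-! ### The triangle inequality for decreasing weights -/

section Norm

variable {H : Type*} [NormedAddCommGroup H] [InnerProductSpace ℂ H] [CompleteSpace H]

theorem choquetSchattenNorm_eq_weightedNorm {α : ℕ → ℝ} (hα : Monotone α) (hα0 : α 0 = 0) {p : ℝ}
    (hp : 1 ≤ p) {a : H →L[ℂ] H} {s : ℕ → ℝ} (hs : IsEigenvalueSequence (CFC.abs a) s) :
    choquetSchattenNorm α p a = weightedNorm (fun k => α (k + 1) - α k) p s := by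
  have hp0 : 0 < p := by linarith
  have h := hs.rpow (CFC.abs_nonneg a) hp0
  rw [choquetSchattenNorm, choquetTrace, h.eigenvalueSequence_eq, weightedNorm,
    tsum_sub_mul_eq_tsum_mul hα hα0 h.antitone h.tendsto_zero]
  simp only [ENNReal.ofReal_rpow_of_nonneg (hs.nonneg _) hp0.le]

theorem choquetSchattenNorm_add_le (hH : ¬ FiniteDimensional ℂ H) {α : ℕ → ℝ} (hα : Monotone α)
    (hα0 : α 0 = 0) (hc : Antitone fun k => α (k + 1) - α k) {p : ℝ} (hp : 1 ≤ p)
    {a b : H →L[ℂ] H} (ha : IsCompactOperator a) (hb : IsCompactOperator b) :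
    choquetSchattenNorm α p (a + b) ≤ choquetSchattenNorm α p a + choquetSchattenNorm α p b := by
  obtain ⟨s, hs⟩ := exists_isEigenvalueSequence_abs hH ha
  obtain ⟨t, ht⟩ := exists_isEigenvalueSequence_abs hH hb
  obtain ⟨w, hw⟩ := exists_isEigenvalueSequence_abs hH (a := a + b) (ha.add hb)
  rw [choquetSchattenNorm_eq_weightedNorm hα hα0 hp hs,
    choquetSchattenNorm_eq_weightedNorm hα hα0 hp ht,
    choquetSchattenNorm_eq_weightedNorm hα hα0 hp hw]
  exact weightedNorm_le_add hp hc (fun k => sub_nonneg.2 (hα k.le_succ)) hw.antitone hw.nonneg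
    hs.nonneg ht.nonneg (sum_eigenvalues_abs_add_le hs ht hw)

end Norm

/-! ### Diagonal test operators and the converse -/

section Diagonal

variable {H : Type*} [NormedAddCommGroup H] [InnerProductSpace ℂ H]

/-- The diagonal operator `∑_{k < N} x_k e_k ⊗ e_k`. -/
noncomputable def diagonalOperator (e : ℕ → H) (N : ℕ) (x : ℕ → ℝ) : H →L[ℂ] H :=
  ∑ k ∈ Finset.range N, (x k : ℂ) • InnerProductSpace.rankOne ℂ (e k) (e k)

theorem diagonalOperator_apply (e : ℕ → H) (N : ℕ) (x : ℕ → ℝ) (y : H) :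
    diagonalOperator e N x y = ∑ k ∈ Finset.range N, (x k : ℂ) • (inner ℂ (e k) y • e k) := by
  simp [diagonalOperator, sum_apply]

theorem isEigenvalueSequence_diagonalOperator {e : ℕ → H} (he : Orthonormal ℂ e) {N : ℕ}
    {x : ℕ → ℝ} (hx : Antitone x) (hxN : ∀ k, N ≤ k → x k = 0) :
    IsEigenvalueSequence (diagonalOperator e N x) x where
  antitone := hx
  tendsto_zero := tendsto_const_nhds.congr' <| by
    filter_upwards [Filter.eventually_ge_atTop N] with k hk using (hxN k hk).symm
  decomposition := ⟨e, he, fun y => by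
    rw [diagonalOperator_apply]
    refine hasSum_sum_of_ne_finset_zero fun k hk => ?_
    rw [hxN k (by simpa using hk)]
    simp⟩

theorem diagonalOperator_nonneg (e : ℕ → H) (N : ℕ) {x : ℕ → ℝ} (hx : ∀ k, 0 ≤ x k) :
    0 ≤ diagonalOperator e N x := by
  rw [ContinuousLinearMap.nonneg_iff_isPositive]
  refine ContinuousLinearMap.isPositive_sum _ fun k _ => ?_
  exact (InnerProductSpace.isPositive_rankOne_self (e k)).smul_of_nonneg
    (by exact_mod_cast hx k)

theorem isCompactOperator_rankOne (x y : H) :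
    IsCompactOperator (InnerProductSpace.rankOne ℂ x y) := by
  rw [InnerProductSpace.rankOne_def']
  exact ((isCompactOperator_id (E := ℂ)).clm_comp
    (ContinuousLinearMap.toSpanSingleton ℂ x)).comp_clm (innerSL ℂ y)

theorem isCompactOperator_diagonalOperator (e : ℕ → H) (N : ℕ) (x : ℕ → ℝ) :
    IsCompactOperator (diagonalOperator e N x) := by
  rw [diagonalOperator]
  induction N with
  | zero => simpa using isCompactOperator_zero
  | succ N ih =>
    rw [Finset.sum_range_succ]
    exact ih.add ((isCompactOperator_rankOne (e N) (e N)).smul (x N : ℂ))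

/-- The sequence `(1, …, 1, u, v, 0, …)` starting with `m` ones, scaled by `t`. -/
def stepSequence (m : ℕ) (t u v : ℝ) (k : ℕ) : ℝ :=
  if k < m then t else if k = m then u else if k = m + 1 then v else 0

theorem stepSequence_antitone (m : ℕ) {t u v : ℝ} (htu : u ≤ t) (huv : v ≤ u) (hv : 0 ≤ v) :
    Antitone (stepSequence m t u v) := by
  intro i j hij
  unfold stepSequence
  split_ifs <;> first | omega | linarith

theorem stepSequence_nonneg (m : ℕ) {t u v : ℝ} (ht : 0 ≤ t) (hu : 0 ≤ u) (hv : 0 ≤ v) (k : ℕ) :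
    0 ≤ stepSequence m t u v k := by
  unfold stepSequence
  split_ifs <;> first | assumption | rfl

theorem stepSequence_eq_zero (m : ℕ) (t u v : ℝ) (k : ℕ) (hk : m + 2 ≤ k) :
    stepSequence m t u v k = 0 := by
  unfold stepSequence
  split_ifs <;> first | omega | rfl

theorem sum_range_stepSequence {M : Type*} [AddCommMonoid M] (f : ℕ → ℝ → M) (m : ℕ) (t u v : ℝ) :
    ∑ k ∈ Finset.range (m + 2), f k (stepSequence m t u v k) =
      ∑ k ∈ Finset.range m, f k t + f m u + f (m + 1) v := by
  rw [Finset.sum_range_succ, Finset.sum_range_succ]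
  congr 2
  · exact Finset.sum_congr rfl fun k hk => by simp [stepSequence, Finset.mem_range.1 hk]
  · simp [stepSequence]
  · simp [stepSequence]

theorem diagonalOperator_add_swap (e : ℕ → H) (m : ℕ) (t u v : ℝ) :
    diagonalOperator e (m + 2) (stepSequence m t u v) +
      diagonalOperator (e ∘ Equiv.swap m (m + 1)) (m + 2) (stepSequence m t u v) =
      diagonalOperator e (m + 2) (stepSequence m (2 * t) (u + v) (u + v)) := by
  simp only [diagonalOperator, Function.comp_apply]
  rw [sum_range_stepSequence (fun k x => (x : ℂ) • InnerProductSpace.rankOne ℂ (e k) (e k)),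
    sum_range_stepSequence (fun k x => (x : ℂ) • InnerProductSpace.rankOne ℂ
      (e (Equiv.swap m (m + 1) k)) (e (Equiv.swap m (m + 1) k))),
    sum_range_stepSequence (fun k x => (x : ℂ) • InnerProductSpace.rankOne ℂ (e k) (e k)),
    Equiv.swap_apply_left, Equiv.swap_apply_right]
  have h : ∑ k ∈ Finset.range m, (t : ℂ) • InnerProductSpace.rankOne ℂ
      (e (Equiv.swap m (m + 1) k)) (e (Equiv.swap m (m + 1) k)) =
      ∑ k ∈ Finset.range m, (t : ℂ) • InnerProductSpace.rankOne ℂ (e k) (e k) := by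
    refine Finset.sum_congr rfl fun k hk => ?_
    have := Finset.mem_range.1 hk
    rw [Equiv.swap_apply_of_ne_of_ne (by omega) (by omega)]
  rw [h]
  push_cast
  simp only [two_mul, add_smul, Finset.sum_add_distrib]
  abel

theorem weightedNorm_stepSequence {α : ℕ → ℝ} (hα : Monotone α) (hα0 : α 0 = 0) {p : ℝ}
    (hp : 1 ≤ p) (m : ℕ) {t u v : ℝ} (ht : 0 ≤ t) (hu : 0 ≤ u) (hv : 0 ≤ v) :
    weightedNorm (fun k => α (k + 1) - α k) p (stepSequence m t u v) =
      ENNReal.ofReal (α m * t ^ p + (α (m + 1) - α m) * u ^ p +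
        (α (m + 2) - α (m + 1)) * v ^ p) ^ (1 / p) := by
  have hp0 : 0 < p := by linarith
  have hs := stepSequence_nonneg m ht hu hv
  rw [weightedNorm, tsum_eq_sum (s := Finset.range (m + 2))]
  · simp only [ENNReal.ofReal_rpow_of_nonneg (hs _) hp0.le,
      ← ENNReal.ofReal_mul (sub_nonneg.2 (hα (Nat.le_succ _)))]
    rw [← ENNReal.ofReal_sum_of_nonneg fun k _ =>
        mul_nonneg (sub_nonneg.2 (hα k.le_succ)) (Real.rpow_nonneg (hs k) p),
      sum_range_stepSequence (fun k x => (α (k + 1) - α k) * x ^ p), ← Finset.sum_mul,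
      Finset.sum_range_sub, hα0, sub_zero]
  · intro k hk
    rw [stepSequence_eq_zero m t u v k (by simpa using hk), ENNReal.ofReal_zero,
      ENNReal.zero_rpow_of_pos hp0, mul_zero]

/-- The difference of the two sides is nonnegative on `[0, 1]` and vanishes at `1`, so its
derivative there, `p * (d - c) / 2`, cannot be positive. -/
theorem le_of_forall_midpoint_rpow_le {p c d : ℝ} (hp : 1 ≤ p)
    (h : ∀ r ∈ Set.Icc (0 : ℝ) 1, (c + d) * ((1 + r) / 2) ^ p ≤ c + d * r ^ p) : d ≤ c := by
  set g : ℝ → ℝ := fun r => c + d * r ^ p - (c + d) * ((1 + r) / 2) ^ p with hg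
  have hderiv : HasDerivAt g (p * (d - c) / 2) 1 := by
    have h1 : HasDerivAt (fun r : ℝ => r ^ p) (p * 1 ^ (p - 1)) 1 :=
      Real.hasDerivAt_rpow_const (Or.inr hp)
    have h2 : HasDerivAt (fun r : ℝ => (1 + r) / 2) (1 / 2) 1 :=
      ((hasDerivAt_id (1 : ℝ)).const_add 1).div_const 2
    have h3 := h2.rpow_const (p := p) (Or.inr hp)
    have h4 := ((h1.const_mul d).const_add c).sub (h3.const_mul (c + d))
    refine h4.congr_deriv ?_
    norm_num
    ring
  have hg1 : g 1 = 0 := by simp [hg]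
  by_contra! hlt
  have hpos : 0 < p * (d - c) / 2 := by
    have := mul_pos (by linarith : 0 < p) (sub_pos.2 hlt)
    linarith
  have h5 := (hasDerivAt_iff_tendsto_slope.1 hderiv).eventually_const_lt hpos
  have h6 : ∀ᶠ r in nhdsWithin (1 : ℝ) (Set.Iio 1), 0 < slope g 1 r :=
    h5.filter_mono (nhdsWithin_mono _ fun r hr => ne_of_lt hr)
  have h7 : ∀ᶠ r in nhdsWithin (1 : ℝ) (Set.Iio 1), (0 : ℝ) < r :=
    (lt_mem_nhds one_pos).filter_mono nhdsWithin_le_nhds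
  obtain ⟨r, ⟨hr1, hr2⟩, hr3⟩ := ((h6.and h7).and self_mem_nhdsWithin).exists
  rw [slope_def_field, hg1, sub_zero] at hr1
  have h8 : 0 ≤ g r := sub_nonneg.2 (h r ⟨hr2.le, le_of_lt hr3⟩)
  exact absurd hr1 (not_lt.2 (div_nonpos_of_nonneg_of_nonpos h8 (sub_nonpos.2 (le_of_lt hr3))))

variable [CompleteSpace H]

theorem choquetSchattenNorm_diagonalOperator {α : ℕ → ℝ} (hα : Monotone α) (hα0 : α 0 = 0)
    {p : ℝ} (hp : 1 ≤ p) {e : ℕ → H} (he : Orthonormal ℂ e) (m : ℕ) {t u v : ℝ} (htu : u ≤ t)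
    (huv : v ≤ u) (hv : 0 ≤ v) :
    choquetSchattenNorm α p (diagonalOperator e (m + 2) (stepSequence m t u v)) =
      ENNReal.ofReal (α m * t ^ p + (α (m + 1) - α m) * u ^ p +
        (α (m + 2) - α (m + 1)) * v ^ p) ^ (1 / p) := by
  have hu := hv.trans huv
  have ht := hu.trans htu
  have habs : CFC.abs (diagonalOperator e (m + 2) (stepSequence m t u v)) =
      diagonalOperator e (m + 2) (stepSequence m t u v) :=
    CFC.abs_of_nonneg _ (diagonalOperator_nonneg _ _ (stepSequence_nonneg m ht hu hv))
  have hs : IsEigenvalueSequence (CFC.abs (diagonalOperator e (m + 2) (stepSequence m t u v)))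
      (stepSequence m t u v) := by
    rw [habs]
    exact isEigenvalueSequence_diagonalOperator he (stepSequence_antitone m htu huv hv)
      (stepSequence_eq_zero m t u v)
  exact (choquetSchattenNorm_eq_weightedNorm hα hα0 hp hs).trans
    (weightedNorm_stepSequence hα hα0 hp m ht hu hv)

theorem antitone_of_choquetSchattenNorm_add_le (hH : ¬ FiniteDimensional ℂ H) {α : ℕ → ℝ}
    (hα : Monotone α) (hα0 : α 0 = 0) {p : ℝ} (hp : 1 ≤ p)
    (h : ∀ a b : H →L[ℂ] H, IsCompactOperator a → IsCompactOperator b →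
      choquetSchattenNorm α p (a + b) ≤ choquetSchattenNorm α p a + choquetSchattenNorm α p b) :
    Antitone fun k => α (k + 1) - α k := by
  have hp0 : 0 < p := by linarith
  -- The zero operator serves only to produce an orthonormal sequence.
  obtain ⟨e, -, he, -⟩ := exists_eigenvector_seq hH (T := 0) le_rfl isCompactOperator_zero
  refine antitone_nat_of_succ_le fun m => le_of_forall_midpoint_rpow_le hp fun r hr => ?_
  have h1 := h _ _ (isCompactOperator_diagonalOperator e (m + 2) (stepSequence m 1 1 r))
    (isCompactOperator_diagonalOperator (e ∘ Equiv.swap m (m + 1)) (m + 2) (stepSequence m 1 1 r))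
  have he' : Orthonormal ℂ (e ∘ Equiv.swap m (m + 1)) := he.comp _ (Equiv.injective _)
  rw [diagonalOperator_add_swap, choquetSchattenNorm_diagonalOperator hα hα0 hp he m le_rfl hr.2 hr.1,
    choquetSchattenNorm_diagonalOperator hα hα0 hp he' m le_rfl hr.2 hr.1,
    choquetSchattenNorm_diagonalOperator hα hα0 hp he m (by linarith [hr.2]) le_rfl
      (by linarith [hr.1]), ← two_mul, one_div, ENNReal.rpow_inv_le_iff hp0,
    ENNReal.mul_rpow_of_nonneg _ _ hp0.le, ENNReal.rpow_inv_rpow hp0.ne'] at h1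
  have hα00 : ∀ k, 0 ≤ α k := fun k => hα0 ▸ hα k.zero_le
  have hc := fun k => sub_nonneg.2 (hα (Nat.le_succ k))
  have hrp := Real.rpow_nonneg hr.1 p
  have h2p : (2 : ℝ≥0∞) ^ p = ENNReal.ofReal (2 ^ p) := by
    rw [← ENNReal.ofReal_rpow_of_pos two_pos, ENNReal.ofReal_ofNat]
  rw [h2p, ← ENNReal.ofReal_mul (by positivity), ENNReal.ofReal_le_ofReal_iff (by
    have := hα00 m
    have := hc m
    have := mul_nonneg (hc (m + 1)) hrp
    simp only [Real.one_rpow, mul_one]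
    simp only [Nat.succ_eq_add_one] at *
    have := add_nonneg (add_nonneg ‹0 ≤ α m› ‹0 ≤ α (m + 1) - α m›) this
    positivity)] at h1
  simp only [mul_one, Real.one_rpow] at h1
  -- Both sides of `h1` contain `α m * 2 ^ p`, from the first `m` eigenvalues; it cancels.
  rw [Real.div_rpow (by linarith [hr.1]) two_pos.le, ← mul_div_assoc,
    div_le_iff₀ (Real.rpow_pos_of_pos two_pos p)]
  linarith

end Diagonal

/-! ### Reindexing of the conditions on `α` and conclusion -/

theorem antitoneOn_Ici_one_iff (α : ℕ → ℝ) :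
    AntitoneOn (fun i : ℕ => α i - α (i - 1)) (Set.Ici 1) ↔
      Antitone fun k => α (k + 1) - α k := by
  refine ⟨fun h i j hij => ?_, fun h i hi j hj hij => ?_⟩
  · exact h (Set.mem_Ici.2 (Nat.le_add_left 1 i)) (Set.mem_Ici.2 (Nat.le_add_left 1 j)) (by omega)
  · have := h (show i - 1 ≤ j - 1 by omega)
    simpa only [Nat.sub_add_cancel hi, Nat.sub_add_cancel hj] using this

theorem forall_midpoint_le_iff (α : ℕ → ℝ) :
    (∀ i : ℕ, 1 ≤ i → (α (i + 1) + α (i - 1)) / 2 ≤ α i) ↔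
      Antitone fun k => α (k + 1) - α k := by
  refine ⟨fun h => antitone_nat_of_succ_le fun k => ?_, fun h i hi => ?_⟩
  · have := h (k + 1) (by omega)
    rw [Nat.add_sub_cancel] at this
    linarith
  · have := h (Nat.sub_le i 1)
    simp only [Nat.sub_add_cancel hi] at this
    linarith

theorem mainTheorem5 {H : Type*} [NormedAddCommGroup H] [InnerProductSpace ℂ H] [CompleteSpace H]
    [TopologicalSpace.SeparableSpace H] (hH : ¬ FiniteDimensional ℂ H)
    (p : ℝ) (hp : 1 ≤ p)
    (α : ℕ → ℝ) (hα : Monotone α) (hα0 : α 0 = 0) (hα1 : 0 < α 1) :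
    List.TFAE
      [∀ i : ℕ, 1 ≤ i → (α (i + 1) + α (i - 1)) / 2 ≤ α i,
       AntitoneOn (fun i : ℕ => α i - α (i - 1)) (Set.Ici 1),
       ∀ a b : H →L[ℂ] H, IsCompactOperator a → IsCompactOperator b →
         choquetSchattenNorm α p (a + b) ≤
           choquetSchattenNorm α p a + choquetSchattenNorm α p b] := by
  rw [forall_midpoint_le_iff, antitoneOn_Ici_one_iff]
  tfae_have 1 ↔ 2 := Iff.rfl
  tfae_have 2 → 3 := fun h a b ha hb => choquetSchattenNorm_add_le hH hα hα0 h hp ha hb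
  tfae_have 3 → 2 := antitone_of_choquetSchattenNorm_add_le hH hα hα0 hp
  tfae_finish
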